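/- Let $p\ge 1$, and let $Y$ be a real random variable and $X$ a random vector in $\mathbb{R}^p$, defined on a common probability space, with $E(Y^2)<\infty$, $E(\|X\|^2)<\infty$, $V(Y)>0$ and $V(X)$ nonsingular. Assume that $E(Y\mid X)=\alpha_0+X'\beta_0$ almost surely for some $(\alpha_0,\beta_0)\in\mathbb{R}\times\mathbb{R}^p$. For an integrable random variable or vector $A$, write $A_0=A-E(A)$, and let $F_A$ be the cdf of a real random variable $A$. For a cdf $F$ on $\mathbb{R}$ let $F^{-1}(t)=\inf\{x: F(x)\ge t\}$. For cdfs $F,G$ with mean zero and $\alpha\in(0,1)$ let $$R(\alpha,F,G)=\frac{\int_\alpha^1F^{-1}(t)\,dt}{\int_\alpha^1G^{-1}(t)\,dt},\qquad S(F,G)=\inf_{\alpha\in(0,1)}R(\alpha,F,G).$$ For integrable real random variables $A,B$, say that $A$ dominates $B$ in the convex order if $E[\phi(A)]\ge E[\phi(B)]$ for every convex $\phi:\mathbb{R}\to\mathbb{R}$ (expectations taken in $(-\infty,+\infty]$). The sharp identified set of $\beta_0$ from the marginal distributions of $Y$ and $X$ is the set $\mathcal{B}$ of all $\beta\in\mathbb{R}^p$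 for which there exist random variables $\widetilde X,\widetilde Y$ on a common probability space such that $\widetilde X$ has the distribution of $X$, $\widetilde Y$ has the distribution of $Y$, and $E(\widetilde Y_0\mid\widetilde X_0)=\widetilde X_0'\beta$ almost surely. Then $$\mathcal{B}=\left\{\lambda q:\ q\in\mathbb{R}^p,\ \|q\|=1,\ 0\le\lambda\le S(F_{Y_0},F_{X_0'q})\right\}=\left\{\beta\in\mathbb{R}^p:\ Y_0\text{ dominates }X_0'\beta\text{ in the convex order}\right\}.$$ Moreover, $\mathcal{B}$ contains $0$, is convex and compact, and $\mathcal{B}\subseteq\{\beta\in\mathbb{R}^p:\ \beta'V(X)\beta\le V(Y)\}$. -/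

import Mathlib

open MeasureTheory ProbabilityTheory

noncomputable section

/-- The centered version `A₀ = A - E(A)` of an integrable random variable (or vector) `A`. -/
def centered {Ω : Type*} [MeasurableSpace Ω] {E : Type*} [NormedAddCommGroup E] [NormedSpace ℝ E]
    (P : Measure Ω) (A : Ω → E) : Ω → E :=
  fun ω => A ω - ∫ ω', A ω' ∂P

/-- The variance-covariance matrix `V(X)` of a random vector `X` in `ℝ^p`. -/
def covMatrix {Ω : Type*} [MeasurableSpace Ω] {p : ℕ}
    (P : Measure Ω) (X : Ω → EuclideanSpace ℝ (Fin p)) : Matrix (Fin p) (Fin p) ℝ :=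
  Matrix.of fun i j => covariance (fun ω => X ω i) (fun ω => X ω j) P

/-- The cdf `F_A` of a real random variable `A`. -/
def cdfOf {Ω : Type*} [MeasurableSpace Ω] (P : Measure Ω) (A : Ω → ℝ) : ℝ → ℝ :=
  fun x => cdf (P.map A) x

/-- The generalized inverse `F⁻¹(t) = inf {x : F(x) ≥ t}` of a cdf `F`. -/
def genInv (F : ℝ → ℝ) (t : ℝ) : ℝ :=
  sInf {x : ℝ | t ≤ F x}

/-- The ratio of superquantiles `R(α, F, G)`. -/
def superquantileRatio (α : ℝ) (F G : ℝ → ℝ) : ℝ :=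
  (∫ t in α..1, genInv F t) / (∫ t in α..1, genInv G t)

/-- `S(F, G) = inf_{α ∈ (0,1)} R(α, F, G)`. -/
def infRatio (F G : ℝ → ℝ) : ℝ :=
  ⨅ α : Set.Ioo (0 : ℝ) 1, superquantileRatio (α : ℝ) F G

/-- The expectation of `Z`, as an extended real number `E(Z⁺) - E(Z⁻)`; it may be `+∞`, and is
meaningful as soon as `E(Z⁻) < ∞`. -/
def extExpectation {Ω : Type*} [MeasurableSpace Ω] (P : Measure Ω) (Z : Ω → ℝ) : EReal :=
  ((∫⁻ ω, ENNReal.ofReal (Z ω) ∂P : ENNReal) : EReal) -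
    ((∫⁻ ω, ENNReal.ofReal (-Z ω) ∂P : ENNReal) : EReal)

/-- `A` dominates `B` in the convex order: both are integrable, and `E(φ(A)) ≥ E(φ(B))` for every
convex function `φ : ℝ → ℝ`, the expectations being taken in `(-∞, +∞]`. -/
def ConvexDominates {Ω : Type*} [MeasurableSpace Ω] (P : Measure Ω) (A B : Ω → ℝ) : Prop :=
  Integrable A P ∧ Integrable B P ∧
    ∀ φ : ℝ → ℝ, ConvexOn ℝ Set.univ φ →
      extExpectation P (fun ω => φ (B ω)) ≤ extExpectation P (fun ω => φ (A ω))

/-- The identified set of the slope coefficient, given the marginal laws `μY` of the outcome and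
`μX` of the covariates: all `β` for which there are random variables `X'`, `Y'` on a common
probability space with these marginal laws and with `E(Y'₀ | X'₀) = X'₀ ⬝ β` almost surely. -/
def identifiedSet {p : ℕ} (μY : Measure ℝ) (μX : Measure (EuclideanSpace ℝ (Fin p))) :
    Set (EuclideanSpace ℝ (Fin p)) :=
  {β | ∃ (Ω' : Type) (_ : MeasurableSpace Ω') (P' : Measure Ω')
      (X' : Ω' → EuclideanSpace ℝ (Fin p)) (Y' : Ω' → ℝ),
      IsProbabilityMeasure P' ∧ Measurable X' ∧ Measurable Y' ∧
      P'.map X' = μX ∧ P'.map Y' = μY ∧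
      P'[centered P' Y' | MeasurableSpace.comap (centered P' X') inferInstance]
        =ᵐ[P'] fun ω => inner ℝ (centered P' X' ω) β}

end

/-!
Between integrable variables with the same mean, the convex order is the pointwise order of the
stop-loss transforms `k ↦ E[(A - k)⁺]`. Jensen's inequality gives one half of the identification.
The other half is Strassen's theorem: given `E[(⟪X₀, β⟫ - k)⁺] ≤ E[(Y₀ - k)⁺]` for all `k`, some
coupling of the two laws satisfies `E[Y₀ | X] = ⟪X₀, β⟫`. The couplings form a weakly compact convex
set, so by Hahn–Banach it is enough to find, for each bounded continuous `φ` separately, a coupling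
with `E[(Y₀ - ⟪X₀, β⟫) φ(X)] ≥ 0`; the comonotone coupling of `φ(X)` and `Y` does this, by the layer
cake formula. Finally, the stop-loss transform and the upper quantile integral
`α ↦ ∫ t in α..1, F⁻¹(t)` determine each other by Rockafellar–Uryasev duality, and the latter is
positively homogeneous; this yields the polar form of the set.
-/

open scoped Topology Pointwise BoundedContinuousFunction
open Set Filter

/-- The stop-loss transform `k ↦ E[(A - k)⁺]`, the test for the convex order used throughout. The
transform of a law `ν` on `ℝ` is `stopLoss ν id`. -/
noncomputable def stopLoss {Ω : Type*} [MeasurableSpace Ω] (P : Measure Ω) (A : Ω → ℝ) (k : ℝ) :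
    ℝ :=
  ∫ ω, max (A ω - k) 0 ∂P

section StopLoss

variable {Ω : Type*} [MeasurableSpace Ω] {P : Measure Ω} {f : Ω → ℝ}

theorem stopLoss_nonneg (k : ℝ) : 0 ≤ stopLoss P f k :=
  integral_nonneg fun _ => le_max_right _ _

theorem stopLoss_map {Ω' : Type*} [MeasurableSpace Ω'] {T : Ω → Ω'} (hT : AEMeasurable T P)
    {g : Ω' → ℝ} (hg : Measurable g) : stopLoss (P.map T) g = stopLoss P (fun ω => g (T ω)) :=
  funext fun _ => integral_map hT (by fun_prop)

variable [IsFiniteMeasure P]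

theorem integrable_max_sub_zero (hf : Integrable f P) (k : ℝ) :
    Integrable (fun ω => max (f ω - k) 0) P :=
  (hf.sub (integrable_const k)).pos_part

theorem setIntegral_eq_mul_add_integral_indicator (hf : Integrable f P) {A : Set Ω}
    (hA : MeasurableSet A) (k : ℝ) :
    ∫ ω in A, f ω ∂P = k * P.real A + ∫ ω, A.indicator (fun ω => f ω - k) ω ∂P := by
  rw [integral_indicator hA, integral_sub hf.restrict (integrable_const k), setIntegral_const,
    smul_eq_mul]
  ring

theorem setIntegral_le_mul_add_stopLoss (hf : Integrable f P) {A : Set Ω} (hA : MeasurableSet A)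
    (k : ℝ) : ∫ ω in A, f ω ∂P ≤ k * P.real A + stopLoss P f k := by
  rw [setIntegral_eq_mul_add_integral_indicator hf hA k]
  gcongr
  refine integral_mono ((hf.sub (integrable_const k)).indicator hA)
    (integrable_max_sub_zero hf k) fun ω => ?_
  exact indicator_apply_le' (fun _ => le_max_left _ _) (fun _ => le_max_right _ _)

theorem setIntegral_eq_mul_add_stopLoss (hf : Integrable f P) {A : Set Ω} (hA : MeasurableSet A)
    {k : ℝ} (hge : ∀ᵐ ω ∂P, ω ∈ A → k ≤ f ω) (hle : ∀ᵐ ω ∂P, ω ∉ A → f ω ≤ k) :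
    ∫ ω in A, f ω ∂P = k * P.real A + stopLoss P f k := by
  rw [setIntegral_eq_mul_add_integral_indicator hf hA k]
  congr 1
  refine integral_congr_ae ?_
  filter_upwards [hge, hle] with ω h₁ h₂
  by_cases hω : ω ∈ A
  · rw [indicator_of_mem hω, max_eq_left (sub_nonneg.2 (h₁ hω))]
  · rw [indicator_of_notMem hω, max_eq_right (sub_nonpos.2 (h₂ hω))]

theorem integral_abs_eq_two_mul_stopLoss_zero (hf : Integrable f P) (hmean : P[f] = 0) :
    ∫ ω, |f ω| ∂P = 2 * stopLoss P f 0 := by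
  have h_abs : ∀ ω, |f ω| = 2 * max (f ω - 0) 0 - f ω := fun ω => by
    rcases le_total 0 (f ω) with h | h
    · rw [sub_zero, max_eq_left h, abs_of_nonneg h]; ring
    · rw [sub_zero, max_eq_right h, abs_of_nonpos h]; ring
  simp_rw [h_abs]
  rw [integral_sub ((integrable_max_sub_zero hf 0).const_mul 2) hf, integral_const_mul, hmean,
    sub_zero, stopLoss]

theorem stopLoss_zero_pos (hf : Integrable f P) (hmean : P[f] = 0) (hne : ¬ f =ᵐ[P] 0) :
    0 < stopLoss P f 0 := by
  have h_norm : 0 < ∫ ω, |f ω| ∂P :=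
    (integral_nonneg fun _ => abs_nonneg _).lt_of_ne' fun h => hne <|
      ((integral_eq_zero_iff_of_nonneg (fun _ => abs_nonneg _) hf.abs).1 h).mono
        fun _ => abs_eq_zero.1
  rw [integral_abs_eq_two_mul_stopLoss_zero hf hmean] at h_norm
  linarith

theorem mul_mean_sub_le_stopLoss [IsProbabilityMeasure P] (hf : Integrable f P) {c : ℝ}
    (hc : c ∈ Icc (0 : ℝ) 1) (k : ℝ) : c * (P[f] - k) ≤ stopLoss P f k := by
  have h_mean : P[f] - k ≤ stopLoss P f k := by
    have h_univ := setIntegral_le_mul_add_stopLoss hf MeasurableSet.univ k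
    rw [setIntegral_univ, probReal_univ, mul_one] at h_univ
    linarith
  calc c * (P[f] - k) ≤ c * stopLoss P f k := mul_le_mul_of_nonneg_left h_mean hc.1
    _ ≤ stopLoss P f k := mul_le_of_le_one_left (stopLoss_nonneg k) hc.2

end StopLoss

/-- The uniform law on the unit interval. It is carried by the open interval because quantiles at
`0` and `1` are junk values of `sInf`. -/
noncomputable def uniformLaw : Measure ℝ := volume.restrict (Ioo 0 1)

instance : IsProbabilityMeasure uniformLaw := ⟨by simp [uniformLaw]⟩

section Quantile

variable {ν : Measure ℝ}

theorem ae_uniformLaw_mem_Ioo : ∀ᵐ t ∂uniformLaw, t ∈ Ioo (0 : ℝ) 1 :=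
  ae_restrict_mem measurableSet_Ioo

theorem restrict_uniformLaw_Ioi {α : ℝ} (hα : 0 ≤ α) :
    uniformLaw.restrict (Ioi α) = volume.restrict (Ioo α 1) := by
  rw [uniformLaw, Measure.restrict_restrict measurableSet_Ioi, ← Ioi_inter_Iio, ← inter_assoc,
    Ioi_inter_Ioi, sup_eq_left.2 hα, Ioi_inter_Iio]

theorem uniformLaw_real_Ioi {α : ℝ} (hα : α ∈ Icc (0 : ℝ) 1) : uniformLaw.real (Ioi α) = 1 - α := by
  rw [← measureReal_restrict_apply_univ, restrict_uniformLaw_Ioi hα.1,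
    measureReal_restrict_apply_univ, Real.volume_real_Ioo_of_le hα.2]

theorem intervalIntegral_eq_setIntegral_uniformLaw {α : ℝ} (hα : α ∈ Icc (0 : ℝ) 1) (f : ℝ → ℝ) :
    ∫ t in α..1, f t = ∫ t in Ioi α, f t ∂uniformLaw := by
  rw [intervalIntegral.integral_of_le hα.2, integral_Ioc_eq_integral_Ioo,
    restrict_uniformLaw_Ioi hα.1]

theorem cdf_mem_Icc (x : ℝ) : cdf ν x ∈ Icc (0 : ℝ) 1 := ⟨cdf_nonneg ν x, cdf_le_one ν x⟩

theorem genInv_cdf_le_iff {t x : ℝ} (ht : t ∈ Ioo (0 : ℝ) 1) :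
    genInv (cdf ν) t ≤ x ↔ t ≤ cdf ν x := by
  set S : Set ℝ := {x | t ≤ cdf ν x}
  have h_nonempty : S.Nonempty := by
    obtain ⟨y, hy⟩ := ((tendsto_cdf_atTop ν).eventually (lt_mem_nhds ht.2)).exists
    exact ⟨y, hy.le⟩
  have h_bddBelow : BddBelow S := by
    obtain ⟨y, hy⟩ := ((tendsto_cdf_atBot ν).eventually (gt_mem_nhds ht.1)).exists
    exact ⟨y, fun z hz => le_of_not_ge fun hzy =>
      (hz.trans (monotone_cdf ν hzy)).not_gt hy⟩
  have h_attained : t ≤ cdf ν (sInf S) := by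
    have h_right : Tendsto (cdf ν) (𝓝[>] sInf S) (𝓝 (cdf ν (sInf S))) :=
      ((cdf ν).right_continuous (sInf S)).mono_left (nhdsWithin_mono _ Ioi_subset_Ici_self)
    refine ge_of_tendsto h_right ?_
    filter_upwards [self_mem_nhdsWithin] with z hz
    obtain ⟨w, hw, hwz⟩ := exists_lt_of_csInf_lt h_nonempty hz
    exact le_trans hw (monotone_cdf ν hwz.le)
  exact ⟨fun h => h_attained.trans (monotone_cdf ν h), fun h => csInf_le h_bddBelow h⟩

theorem lt_genInv_cdf_iff {t x : ℝ} (ht : t ∈ Ioo (0 : ℝ) 1) :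
    x < genInv (cdf ν) t ↔ cdf ν x < t := by
  rw [← not_le, genInv_cdf_le_iff ht, not_le]

theorem monotoneOn_genInv_cdf : MonotoneOn (genInv (cdf ν)) (Ioo 0 1) := fun _s hs _t ht hst =>
  (genInv_cdf_le_iff hs).2 (hst.trans ((genInv_cdf_le_iff ht).1 le_rfl))

theorem aemeasurable_genInv_cdf : AEMeasurable (genInv (cdf ν)) uniformLaw :=
  aemeasurable_restrict_of_monotoneOn measurableSet_Ioo monotoneOn_genInv_cdf

theorem genInv_comp_div (F : ℝ → ℝ) {l : ℝ} (hl : 0 < l) (t : ℝ) :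
    genInv (fun x => F (x / l)) t = l * genInv F t := by
  have h_scale : {x : ℝ | t ≤ F (x / l)} = l • {x : ℝ | t ≤ F x} := by
    ext x
    rw [Set.mem_smul_set_iff_inv_smul_mem₀ hl.ne', smul_eq_mul, ← div_eq_inv_mul]
    rfl
  rw [genInv, h_scale, Real.sInf_smul_of_nonneg hl.le, smul_eq_mul, genInv]

variable [IsProbabilityMeasure ν]

variable (ν) in
theorem map_genInv_cdf_uniformLaw : uniformLaw.map (genInv (cdf ν)) = ν := by
  have : IsProbabilityMeasure (uniformLaw.map (genInv (cdf ν))) :=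
    Measure.isProbabilityMeasure_map aemeasurable_genInv_cdf
  refine Measure.eq_of_cdf _ _ (StieltjesFunction.ext fun x => ?_)
  have h_lt : genInv (cdf ν) ⁻¹' Ioi x =ᵐ[uniformLaw] Ioi (cdf ν x) := by
    filter_upwards [ae_uniformLaw_mem_Ioo] with t ht
    exact propext (lt_genInv_cdf_iff ht)
  rw [cdf_eq_real, ← compl_Ioi, probReal_compl_eq_one_sub measurableSet_Ioi,
    map_measureReal_apply_of_aemeasurable aemeasurable_genInv_cdf measurableSet_Ioi,
    measureReal_congr h_lt, uniformLaw_real_Ioi (cdf_mem_Icc x), sub_sub_cancel]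

theorem integrable_genInv_cdf (hν : Integrable id ν) :
    Integrable (genInv (cdf ν)) uniformLaw := by
  rw [← map_genInv_cdf_uniformLaw ν] at hν
  exact hν.comp_aemeasurable aemeasurable_genInv_cdf

theorem intervalIntegral_zero_one_genInv_cdf : ∫ t in (0 : ℝ)..1, genInv (cdf ν) t = ν[id] := by
  conv_rhs => rw [← map_genInv_cdf_uniformLaw ν]
  rw [integral_map aemeasurable_genInv_cdf (by fun_prop),
    intervalIntegral.integral_of_le zero_le_one, integral_Ioc_eq_integral_Ioo]
  rfl

theorem stopLoss_genInv_cdf (k : ℝ) : stopLoss uniformLaw (genInv (cdf ν)) k = stopLoss ν id k := by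
  conv_rhs => rw [← map_genInv_cdf_uniformLaw ν]
  rw [stopLoss_map aemeasurable_genInv_cdf measurable_id]
  rfl

-- The Rockafellar–Uryasev variational formula: `k` attains the bound when it is an `α`-quantile.
theorem intervalIntegral_genInv_cdf_le (hν : Integrable id ν) {α : ℝ} (hα : α ∈ Icc (0 : ℝ) 1)
    (k : ℝ) : ∫ t in α..1, genInv (cdf ν) t ≤ k * (1 - α) + stopLoss ν id k := by
  rw [intervalIntegral_eq_setIntegral_uniformLaw hα, ← uniformLaw_real_Ioi hα,
    ← stopLoss_genInv_cdf]
  exact setIntegral_le_mul_add_stopLoss (integrable_genInv_cdf hν) measurableSet_Ioi k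

theorem intervalIntegral_genInv_cdf_eq (hν : Integrable id ν) {α : ℝ} (hα : α ∈ Icc (0 : ℝ) 1)
    {k : ℝ} (hge : ∀ t ∈ Ioo (0 : ℝ) 1, α < t → k ≤ genInv (cdf ν) t)
    (hle : ∀ t ∈ Ioo (0 : ℝ) 1, t ≤ α → genInv (cdf ν) t ≤ k) :
    ∫ t in α..1, genInv (cdf ν) t = k * (1 - α) + stopLoss ν id k := by
  rw [intervalIntegral_eq_setIntegral_uniformLaw hα, ← uniformLaw_real_Ioi hα,
    ← stopLoss_genInv_cdf]
  refine setIntegral_eq_mul_add_stopLoss (integrable_genInv_cdf hν) measurableSet_Ioi ?_ ?_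
  · exact ae_uniformLaw_mem_Ioo.mono hge
  · exact ae_uniformLaw_mem_Ioo.mono fun t ht hαt => hle t ht (not_lt.1 hαt)

theorem intervalIntegral_genInv_cdf_eq_genInv (hν : Integrable id ν) {α : ℝ}
    (hα : α ∈ Ioo (0 : ℝ) 1) :
    ∫ t in α..1, genInv (cdf ν) t
      = genInv (cdf ν) α * (1 - α) + stopLoss ν id (genInv (cdf ν) α) :=
  intervalIntegral_genInv_cdf_eq hν (Ioo_subset_Icc_self hα)
    (fun _ ht h => monotoneOn_genInv_cdf hα ht h.le) (fun _ ht h => monotoneOn_genInv_cdf ht hα h)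

theorem intervalIntegral_genInv_cdf_cdf (hν : Integrable id ν) (k : ℝ) :
    ∫ t in (cdf ν k)..1, genInv (cdf ν) t = k * (1 - cdf ν k) + stopLoss ν id k :=
  intervalIntegral_genInv_cdf_eq hν (cdf_mem_Icc k)
    (fun _ ht h => ((lt_genInv_cdf_iff ht).2 h).le) (fun _ ht h => (genInv_cdf_le_iff ht).2 h)

theorem stopLoss_le_iff_intervalIntegral_genInv_cdf_le {μ : Measure ℝ} [IsProbabilityMeasure μ]
    (hμ : Integrable id μ) (hν : Integrable id ν) (hmean : μ[id] = ν[id]) :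
    stopLoss μ id ≤ stopLoss ν id ↔
      ∀ α ∈ Ioo (0 : ℝ) 1, ∫ t in α..1, genInv (cdf μ) t ≤ ∫ t in α..1, genInv (cdf ν) t := by
  refine ⟨fun h α hα => ?_, fun h k => ?_⟩
  · calc ∫ t in α..1, genInv (cdf μ) t
        ≤ genInv (cdf ν) α * (1 - α) + stopLoss μ id (genInv (cdf ν) α) :=
          intervalIntegral_genInv_cdf_le hμ (Ioo_subset_Icc_self hα) _
      _ ≤ genInv (cdf ν) α * (1 - α) + stopLoss ν id (genInv (cdf ν) α) := by gcongr; exact h _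
      _ = ∫ t in α..1, genInv (cdf ν) t := (intervalIntegral_genInv_cdf_eq_genInv hν hα).symm
  · have h_upper : ∫ t in (cdf μ k)..1, genInv (cdf μ) t
        ≤ ∫ t in (cdf μ k)..1, genInv (cdf ν) t := by
      rcases (cdf_nonneg μ k).eq_or_lt with h0 | h0
      · rw [← h0, intervalIntegral_zero_one_genInv_cdf, intervalIntegral_zero_one_genInv_cdf, hmean]
      rcases (cdf_le_one μ k).eq_or_lt with h1 | h1
      · rw [h1, intervalIntegral.integral_same, intervalIntegral.integral_same]
      · exact h _ ⟨h0, h1⟩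
    have h_eq := intervalIntegral_genInv_cdf_cdf hμ k
    have h_le := intervalIntegral_genInv_cdf_le hν (cdf_mem_Icc (ν := μ) k) k
    linarith

theorem mul_mean_le_intervalIntegral_genInv_cdf (hν : Integrable id ν) {α : ℝ}
    (hα : α ∈ Ioo (0 : ℝ) 1) : (1 - α) * ν[id] ≤ ∫ t in α..1, genInv (cdf ν) t := by
  rw [intervalIntegral_genInv_cdf_eq_genInv hν hα]
  have h_stop := mul_mean_sub_le_stopLoss hν (c := 1 - α)
    ⟨sub_nonneg.2 hα.2.le, sub_le_self _ hα.1.le⟩ (genInv (cdf ν) α)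
  linarith

theorem intervalIntegral_genInv_cdf_pos (hν : Integrable id ν) (hmean : ν[id] = 0)
    (hne : ¬ id =ᵐ[ν] 0) {α : ℝ} (hα : α ∈ Ioo (0 : ℝ) 1) :
    0 < ∫ t in α..1, genInv (cdf ν) t := by
  rw [intervalIntegral_genInv_cdf_eq_genInv hν hα]
  rcases lt_trichotomy (genInv (cdf ν) α) 0 with hk | hk | hk
  · have h_stop := mul_mean_sub_le_stopLoss hν ⟨zero_le_one, le_rfl⟩ (genInv (cdf ν) α)
    rw [hmean] at h_stop
    linarith [mul_pos_of_neg_of_neg hk (neg_lt_zero.2 hα.1)]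
  · rw [hk, zero_mul, zero_add]
    exact stopLoss_zero_pos hν hmean hne
  · exact add_pos_of_pos_of_nonneg (mul_pos hk (sub_pos.2 hα.2)) (stopLoss_nonneg _)

end Quantile

/-- The couplings of `μ` and `ν`: the joint laws with these marginals, as a subset of the space of
probability measures, which carries the topology of weak convergence. -/
def couplings {E F : Type*} [MeasurableSpace E] [MeasurableSpace F] (μ : Measure E)
    (ν : Measure F) : Set (ProbabilityMeasure (E × F)) :=
  {π | (π : Measure (E × F)).fst = μ ∧ (π : Measure (E × F)).snd = ν}

section Marginals

variable {E F : Type*} [MeasurableSpace E] [MeasurableSpace F] {μ : Measure E} {ν : Measure F}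
  {π : ProbabilityMeasure (E × F)}

theorem measurePreserving_fst_of_mem_couplings (hπ : π ∈ couplings μ ν) :
    MeasurePreserving Prod.fst (π : Measure (E × F)) μ := ⟨measurable_fst, hπ.1⟩

theorem measurePreserving_snd_of_mem_couplings (hπ : π ∈ couplings μ ν) :
    MeasurePreserving Prod.snd (π : Measure (E × F)) ν := ⟨measurable_snd, hπ.2⟩

theorem integral_comp_fst_of_mem_couplings (hπ : π ∈ couplings μ ν) {f : E → ℝ}
    (hf : AEStronglyMeasurable f μ) : ∫ p, f p.1 ∂(π : Measure (E × F)) = ∫ x, f x ∂μ := by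
  rw [← hπ.1] at hf ⊢
  exact (integral_map measurable_fst.aemeasurable hf).symm

theorem integral_comp_snd_of_mem_couplings (hπ : π ∈ couplings μ ν) {f : F → ℝ}
    (hf : AEStronglyMeasurable f ν) : ∫ p, f p.2 ∂(π : Measure (E × F)) = ∫ y, f y ∂ν := by
  rw [← hπ.2] at hf ⊢
  exact (integral_map measurable_snd.aemeasurable hf).symm

theorem setIntegral_comp_fst_of_mem_couplings (hπ : π ∈ couplings μ ν) {f : E → ℝ}
    (hf : AEStronglyMeasurable f μ) {A : Set E} (hA : MeasurableSet A) :
    ∫ p in Prod.fst ⁻¹' A, f p.1 ∂(π : Measure (E × F)) = ∫ x in A, f x ∂μ := by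
  rw [← hπ.1] at hf ⊢
  exact (setIntegral_map hA hf measurable_fst.aemeasurable).symm

end Marginals

section Comonotone

-- Disintegrating `ρ` over its first marginal and pulling the kernel back along `h` draws the second
-- coordinate of `π` from `h x` alone.
theorem exists_fst_eq_and_map_prodMap_id_eq {E S T : Type*} [MeasurableSpace E]
    [MeasurableSpace S] [MeasurableSpace T] [StandardBorelSpace T] [Nonempty T] (μ : Measure E)
    [SFinite μ] {h : E → S} (hh : Measurable h) (ρ : Measure (S × T)) [IsFiniteMeasure ρ]
    (hρ : ρ.fst = μ.map h) :
    ∃ π : Measure (E × T), π.fst = μ ∧ π.map (Prod.map h id) = ρ := by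
  refine ⟨μ ⊗ₘ ρ.condKernel.comap h hh, Measure.fst_compProd _ _, ?_⟩
  conv_rhs => rw [← ρ.disintegrate ρ.condKernel, hρ]
  ext A hA
  have h_prod : Measurable (Prod.map h (id : T → T)) := hh.prodMap measurable_id
  have : SFinite (μ.map h) := by rw [← hρ]; infer_instance
  rw [Measure.map_apply h_prod hA, Measure.compProd_apply (h_prod hA), Measure.compProd_apply hA,
    lintegral_map (Kernel.measurable_kernel_prodMk_left hA) hh]
  rfl

variable {E : Type*} [MeasurableSpace E]

theorem exists_comonotone_mem_couplings (μ : Measure E) [IsProbabilityMeasure μ] (ν : Measure ℝ)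
    [IsProbabilityMeasure ν] {h : E → ℝ} (hh : Measurable h) :
    ∃ π ∈ couplings μ ν, (π : Measure (E × ℝ)).map (Prod.map h id)
      = uniformLaw.map fun t => (genInv (cdf (μ.map h)) t, genInv (cdf ν) t) := by
  have : IsProbabilityMeasure (μ.map h) := Measure.isProbabilityMeasure_map hh.aemeasurable
  have hq : AEMeasurable (fun t => (genInv (cdf (μ.map h)) t, genInv (cdf ν) t)) uniformLaw :=
    aemeasurable_genInv_cdf.prodMk aemeasurable_genInv_cdf
  set ρ := uniformLaw.map fun t => (genInv (cdf (μ.map h)) t, genInv (cdf ν) t)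
  have hρ_fst : ρ.fst = μ.map h := by
    rw [Measure.fst, AEMeasurable.map_map_of_aemeasurable measurable_fst.aemeasurable hq]
    exact map_genInv_cdf_uniformLaw _
  have hρ_snd : ρ.snd = ν := by
    rw [Measure.snd, AEMeasurable.map_map_of_aemeasurable measurable_snd.aemeasurable hq]
    exact map_genInv_cdf_uniformLaw _
  obtain ⟨π, hπ_fst, hπ_map⟩ := exists_fst_eq_and_map_prodMap_id_eq μ hh ρ hρ_fst
  have : IsProbabilityMeasure π := by
    have : IsProbabilityMeasure (π.map Prod.fst) := by rw [← Measure.fst, hπ_fst]; infer_instance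
    exact Measure.isProbabilityMeasure_of_map Prod.fst
  refine ⟨⟨π, inferInstance⟩, ⟨hπ_fst, ?_⟩, hπ_map⟩
  rw [← hρ_snd, ← hπ_map, Measure.snd, Measure.snd,
    Measure.map_map measurable_snd (hh.prodMap measurable_id)]
  rfl

theorem setIntegral_snd_superlevel_of_map_eq {μ : Measure E} {ν : Measure ℝ} {h : E → ℝ}
    (hh : Measurable h) {π : Measure (E × ℝ)} (hπ : π.map (Prod.map h id)
      = uniformLaw.map fun t => (genInv (cdf (μ.map h)) t, genInv (cdf ν) t)) (s : ℝ) :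
    ∫ p in {p | s < h p.1}, p.2 ∂π = ∫ t in (cdf (μ.map h) s)..1, genInv (cdf ν) t := by
  have hs : MeasurableSet {a : ℝ × ℝ | s < a.1} := measurableSet_lt measurable_const measurable_fst
  have h_upper : (fun t => (genInv (cdf (μ.map h)) t, genInv (cdf ν) t)) ⁻¹' {a | s < a.1}
      =ᵐ[uniformLaw] Ioi (cdf (μ.map h) s) := by
    filter_upwards [ae_uniformLaw_mem_Ioo] with t ht
    exact propext (lt_genInv_cdf_iff ht)
  calc ∫ p in {p | s < h p.1}, p.2 ∂π
      = ∫ a in {a : ℝ × ℝ | s < a.1}, a.2 ∂(π.map (Prod.map h id)) :=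
        (setIntegral_map hs measurable_snd.aestronglyMeasurable
          (hh.prodMap measurable_id).aemeasurable).symm
    _ = ∫ t in Ioi (cdf (μ.map h) s), genInv (cdf ν) t ∂uniformLaw := by
        rw [hπ, setIntegral_map hs measurable_snd.aestronglyMeasurable
          (aemeasurable_genInv_cdf.prodMk aemeasurable_genInv_cdf), setIntegral_congr_set h_upper]
    _ = ∫ t in (cdf (μ.map h) s)..1, genInv (cdf ν) t :=
        (intervalIntegral_eq_setIntegral_uniformLaw (cdf_mem_Icc s) _).symm

theorem setIntegral_le_intervalIntegral_genInv_cdf {μ : Measure E} [IsProbabilityMeasure μ]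
    {ν : Measure ℝ} [IsProbabilityMeasure ν] {f : E → ℝ} (hf : Integrable f μ)
    (hν : Integrable id ν) (hmean : μ[f] = ν[id]) (hle : stopLoss μ f ≤ stopLoss ν id) {A : Set E}
    (hA : MeasurableSet A) : ∫ x in A, f x ∂μ ≤ ∫ t in (1 - μ.real A)..1, genInv (cdf ν) t := by
  rcases (measureReal_nonneg (μ := μ) (s := A)).eq_or_lt with h0 | h0
  · rw [← h0, setIntegral_measure_zero _ ((measureReal_eq_zero_iff).1 h0.symm), sub_zero,
      intervalIntegral.integral_same]
  rcases (measureReal_le_one (μ := μ) (s := A)).eq_or_lt with h1 | h1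
  · have h_full : ∀ᵐ x ∂μ, x ∈ A :=
      (mem_ae_iff_prob_eq_one hA).2 <| (ENNReal.toReal_eq_one_iff _).1 h1
    rw [h1, sub_self, intervalIntegral_zero_one_genInv_cdf, ← hmean,
      Measure.restrict_eq_self_of_ae_mem h_full]
  · rw [intervalIntegral_genInv_cdf_eq_genInv hν ⟨sub_pos.2 h1, sub_lt_self _ h0⟩, sub_sub_cancel]
    exact (setIntegral_le_mul_add_stopLoss hf hA _).trans (add_le_add_right (hle _) _)

end Comonotone

section LayerCake

variable {Ω : Type*} [MeasurableSpace Ω] {P : Measure Ω} {f g : Ω → ℝ} {M : ℝ}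

theorem setIntegral_Ioc_indicator_Iio {a b c : ℝ} (hc : c ∈ Icc a b) (y : ℝ) :
    ∫ s in Ioc a b, (Iio c).indicator (fun _ => y) s = y * (c - a) := by
  have h_inter : Ioc a b ∩ Iio c = Ioo a c := by
    ext s
    simp only [mem_inter_iff, mem_Ioc, mem_Iio, mem_Ioo]
    grind [hc.2]
  rw [setIntegral_indicator measurableSet_Iio, h_inter, setIntegral_const,
    Real.volume_real_Ioo_of_le hc.1, smul_eq_mul, mul_comm]

theorem integral_setIntegral_superlevel_eq [SFinite P] (hf : Integrable f P) (hg : Measurable g)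
    (hM : ∀ ω, |g ω| ≤ M) :
    ∫ s in Ioc (-M) M, ∫ ω in {ω | s < g ω}, f ω ∂P = ∫ ω, f ω * (g ω + M) ∂P := by
  have h_superlevel : MeasurableSet {q : ℝ × Ω | q.1 < g q.2} :=
    measurableSet_lt measurable_fst (hg.comp measurable_snd)
  have h_int : Integrable ({q : ℝ × Ω | q.1 < g q.2}.indicator fun q => f q.2)
      ((volume.restrict (Ioc (-M) M)).prod P) :=
    (hf.comp_snd _).indicator h_superlevel
  calc ∫ s in Ioc (-M) M, ∫ ω in {ω | s < g ω}, f ω ∂P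
      = ∫ s in Ioc (-M) M, ∫ ω, {ω | s < g ω}.indicator f ω ∂P := by
        simp_rw [integral_indicator (measurableSet_lt measurable_const hg)]
    _ = ∫ ω, (∫ s in Ioc (-M) M, (Iio (g ω)).indicator (fun _ => f ω) s) ∂P :=
        integral_integral_swap h_int
    _ = ∫ ω, f ω * (g ω + M) ∂P := by
        refine integral_congr_ae (ae_of_all _ fun ω => ?_)
        simp only [setIntegral_Ioc_indicator_Iio (abs_le.1 (hM ω)), sub_neg_eq_add]

theorem integral_mul_nonneg_of_setIntegral_superlevel_nonneg [SFinite P] (hf : Integrable f P)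
    (hf0 : P[f] = 0) (hg : Measurable g) (hM : ∀ ω, |g ω| ≤ M)
    (h : ∀ s, 0 ≤ ∫ ω in {ω | s < g ω}, f ω ∂P) : 0 ≤ ∫ ω, f ω * g ω ∂P := by
  have hfg : Integrable (fun ω => f ω * g ω) P :=
    hf.mul_bdd hg.aestronglyMeasurable (ae_of_all _ hM)
  calc 0 ≤ ∫ s in Ioc (-M) M, ∫ ω in {ω | s < g ω}, f ω ∂P := integral_nonneg h
    _ = ∫ ω, (f ω * g ω + f ω * M) ∂P := by
        simp_rw [integral_setIntegral_superlevel_eq hf hg hM, mul_add]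
    _ = ∫ ω, f ω * g ω ∂P := by
        rw [integral_add hfg (hf.mul_const M), integral_mul_const, hf0, zero_mul, add_zero]

-- The comonotone coupling of `h` with `ν` maximizes the cross moment with `h`.
theorem exists_mem_couplings_integral_sub_mul_nonneg {E : Type*} [MeasurableSpace E]
    {μ : Measure E} [IsProbabilityMeasure μ] {ν : Measure ℝ} [IsProbabilityMeasure ν]
    (hν : Integrable id ν) {z : E → ℝ} (hz : Integrable z μ) (hmean : μ[z] = ν[id])
    (hle : stopLoss μ z ≤ stopLoss ν id) {h : E → ℝ} (hh : Measurable h) (hM : ∀ x, |h x| ≤ M) :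
    ∃ π ∈ couplings μ ν, 0 ≤ ∫ p, (p.2 - z p.1) * h p.1 ∂(π : Measure (E × ℝ)) := by
  obtain ⟨π, hπ, hπ_map⟩ := exists_comonotone_mem_couplings μ ν hh
  have : IsProbabilityMeasure (μ.map h) := Measure.isProbabilityMeasure_map hh.aemeasurable
  have hy : Integrable (fun p : E × ℝ => p.2) (π : Measure (E × ℝ)) :=
    (measurePreserving_snd_of_mem_couplings hπ).integrable_comp_of_integrable hν
  have hzx : Integrable (fun p : E × ℝ => z p.1) (π : Measure (E × ℝ)) :=
    (measurePreserving_fst_of_mem_couplings hπ).integrable_comp_of_integrable hz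
  refine ⟨π, hπ, integral_mul_nonneg_of_setIntegral_superlevel_nonneg (hy.sub hzx) ?_
    (hh.comp measurable_fst) (fun p => hM p.1) fun s => ?_⟩
  · rw [integral_sub hy hzx, integral_comp_fst_of_mem_couplings hπ hz.1, hmean, sub_eq_zero]
    exact integral_comp_snd_of_mem_couplings hπ hν.1
  · have hs : MeasurableSet {x | s < h x} := measurableSet_lt measurable_const hh
    have h_cdf : 1 - μ.real {x | s < h x} = cdf (μ.map h) s := by
      rw [cdf_eq_real, map_measureReal_apply hh measurableSet_Iic, ← probReal_compl_eq_one_sub hs,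
        compl_ofPred]
      simp only [not_lt, preimage, mem_Iic]
    have h_le := setIntegral_le_intervalIntegral_genInv_cdf hz hν hmean hle hs
    rw [h_cdf, ← setIntegral_snd_superlevel_of_map_eq hh hπ_map s,
      ← setIntegral_comp_fst_of_mem_couplings hπ hz.1 hs] at h_le
    rw [integral_sub hy.restrict hzx.restrict]
    exact sub_nonneg.2 h_le

end LayerCake

section Couplings

variable {E F : Type*} [MeasurableSpace E] [MeasurableSpace F] {μ : Measure E} {ν : Measure F}

theorem exists_mem_couplings_integral_eq_add {π₁ π₂ : ProbabilityMeasure (E × F)}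
    (h₁ : π₁ ∈ couplings μ ν) (h₂ : π₂ ∈ couplings μ ν) {a b : ℝ} (ha : 0 ≤ a) (hb : 0 ≤ b)
    (hab : a + b = 1) :
    ∃ π ∈ couplings μ ν, ∀ f : E × F → ℝ, Integrable f (π₁ : Measure (E × F)) →
      Integrable f (π₂ : Measure (E × F)) →
        ∫ p, f p ∂(π : Measure (E × F))
          = a * ∫ p, f p ∂(π₁ : Measure (E × F)) + b * ∫ p, f p ∂(π₂ : Measure (E × F)) := by
  have hab' : ENNReal.ofReal a + ENNReal.ofReal b = 1 := by
    rw [← ENNReal.ofReal_add ha hb, hab, ENNReal.ofReal_one]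
  refine ⟨⟨ENNReal.ofReal a • (π₁ : Measure (E × F)) + ENNReal.ofReal b • π₂, ⟨?_⟩⟩, ⟨?_, ?_⟩,
    fun f hf₁ hf₂ => ?_⟩
  · simpa using hab'
  · rw [ProbabilityMeasure.coe_mk, Measure.fst, Measure.map_add _ _ measurable_fst,
      Measure.map_smul, Measure.map_smul, ← Measure.fst, ← Measure.fst, h₁.1, h₂.1, ← add_smul,
      hab', one_smul]
  · rw [ProbabilityMeasure.coe_mk, Measure.snd, Measure.map_add _ _ measurable_snd,
      Measure.map_smul, Measure.map_smul, ← Measure.snd, ← Measure.snd, h₁.2, h₂.2, ← add_smul,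
      hab', one_smul]
  · rw [ProbabilityMeasure.coe_mk, integral_add_measure (hf₁.smul_measure ENNReal.ofReal_ne_top)
      (hf₂.smul_measure ENNReal.ofReal_ne_top), integral_smul_measure, integral_smul_measure,
      ENNReal.toReal_ofReal ha, ENNReal.toReal_ofReal hb, smul_eq_mul, smul_eq_mul]

variable [TopologicalSpace E] [BorelSpace E] [TopologicalSpace F] [PolishSpace F] [BorelSpace F]

-- Approximating `f` in `L¹(ν)` by bounded continuous functions is uniform over the couplings,
-- because they share the second marginal.
theorem continuousOn_couplings_integral_mul [IsFiniteMeasure ν] {f : F → ℝ} (hf : Integrable f ν)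
    (φ : E →ᵇ ℝ) :
    ContinuousOn (fun π : ProbabilityMeasure (E × F) =>
      ∫ p, f p.2 * φ p.1 ∂(π : Measure (E × F))) (couplings μ ν) := by
  refine continuousOn_of_uniform_approx_of_continuousOn fun u hu => ?_
  obtain ⟨ε, hε, hεu⟩ := Metric.mem_uniformity_dist.1 hu
  obtain ⟨g, hfg, hg⟩ := hf.exists_boundedContinuous_integral_sub_le
    (ε := ε / (2 * (‖φ‖ + 1))) (by positivity)
  let G : E × F →ᵇ ℝ := g.compContinuous ⟨Prod.snd, continuous_snd⟩ *
    φ.compContinuous ⟨Prod.fst, continuous_fst⟩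
  refine ⟨fun π => ∫ p, G p ∂(π : Measure (E × F)), ?_, fun π hπ => hεu ?_⟩
  · exact (continuous_iff_continuousAt.2 fun _ =>
      (ProbabilityMeasure.tendsto_iff_forall_integral_tendsto.1 tendsto_id) G).continuousOn
  have h_snd := measurePreserving_snd_of_mem_couplings hπ
  have hφ : ∀ᵐ p ∂(π : Measure (E × F)), ‖φ p.1‖ ≤ ‖φ‖ := ae_of_all _ fun p => φ.norm_coe_le_norm _
  have hφ_meas : AEStronglyMeasurable (fun p : E × F => φ p.1) (π : Measure (E × F)) :=
    (φ.continuous.comp continuous_fst).aestronglyMeasurable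
  have hfφ : Integrable (fun p : E × F => f p.2 * φ p.1) (π : Measure (E × F)) :=
    (h_snd.integrable_comp_of_integrable hf).mul_bdd hφ_meas hφ
  have hgφ : Integrable (fun p : E × F => g p.2 * φ p.1) (π : Measure (E × F)) :=
    (h_snd.integrable_comp_of_integrable hg).mul_bdd hφ_meas hφ
  have h_norm : Integrable (fun y => ‖f y - g y‖) ν := (hf.sub hg).norm
  calc dist (∫ p, f p.2 * φ p.1 ∂(π : Measure (E × F))) (∫ p, G p ∂(π : Measure (E × F)))
      = ‖∫ p, (f p.2 * φ p.1 - g p.2 * φ p.1) ∂(π : Measure (E × F))‖ := by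
        rw [dist_eq_norm, integral_sub hfφ hgφ]; rfl
    _ ≤ ∫ p, ‖f p.2 - g p.2‖ * ‖φ‖ ∂(π : Measure (E × F)) := by
        refine norm_integral_le_of_norm_le
          ((h_snd.integrable_comp_of_integrable h_norm).mul_const _) (hφ.mono fun p hp => ?_)
        rw [← sub_mul, norm_mul]
        gcongr
    _ = (∫ y, ‖f y - g y‖ ∂ν) * ‖φ‖ := by
        rw [integral_mul_const]
        exact congrArg (· * ‖φ‖) (integral_comp_snd_of_mem_couplings hπ h_norm.1)
    _ ≤ ε / (2 * (‖φ‖ + 1)) * (‖φ‖ + 1) := by gcongr; linarith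
    _ = ε / 2 := by field_simp
    _ < ε := half_lt_self hε

variable [PolishSpace E]

theorem isClosed_couplings (μ : Measure E) [IsProbabilityMeasure μ] (ν : Measure F)
    [IsProbabilityMeasure ν] : IsClosed (couplings μ ν) := by
  let μ' : ProbabilityMeasure E := ⟨μ, inferInstance⟩
  let ν' : ProbabilityMeasure F := ⟨ν, inferInstance⟩
  have h_eq : couplings μ ν = {π | π.map (f := Prod.fst) (by fun_prop) = μ'}
      ∩ {π | π.map (f := Prod.snd) (by fun_prop) = ν'} := by
    ext π
    exact and_congr ⟨fun h => Subtype.ext h, congrArg Subtype.val⟩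
      ⟨fun h => Subtype.ext h, congrArg Subtype.val⟩
  rw [h_eq]
  exact (isClosed_eq (ProbabilityMeasure.continuous_map continuous_fst) continuous_const).inter
    (isClosed_eq (ProbabilityMeasure.continuous_map continuous_snd) continuous_const)

theorem isCompact_couplings (μ : Measure E) [IsProbabilityMeasure μ] (ν : Measure F)
    [IsProbabilityMeasure ν] : IsCompact (couplings μ ν) := by
  rw [← (isClosed_couplings μ ν).closure_eq]
  refine isCompact_closure_of_isTightMeasureSet ?_
  rw [isTightMeasureSet_iff_exists_isCompact_measure_compl_le]
  intro ε hε
  obtain ⟨K, hK, hμK⟩ := isTightMeasureSet_iff_exists_isCompact_measure_compl_le.1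
    (isTightMeasureSet_singleton (μ := μ)) _ (ENNReal.half_pos hε.ne')
  obtain ⟨L, hL, hνL⟩ := isTightMeasureSet_iff_exists_isCompact_measure_compl_le.1
    (isTightMeasureSet_singleton (μ := ν)) _ (ENNReal.half_pos hε.ne')
  refine ⟨K ×ˢ L, hK.prod hL, ?_⟩
  rintro _ ⟨π, ⟨hπ_fst, hπ_snd⟩, rfl⟩
  have h_cover : (K ×ˢ L)ᶜ = (Prod.fst ⁻¹' Kᶜ : Set (E × F)) ∪ Prod.snd ⁻¹' Lᶜ := by
    rw [Set.prod_eq, compl_inter, preimage_compl, preimage_compl]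
  calc (π : Measure (E × F)) (K ×ˢ L)ᶜ
      ≤ (π : Measure (E × F)) (Prod.fst ⁻¹' Kᶜ) + (π : Measure (E × F)) (Prod.snd ⁻¹' Lᶜ) :=
        h_cover ▸ measure_union_le _ _
    _ = μ Kᶜ + ν Lᶜ := by
        rw [← Measure.fst_apply hK.isClosed.measurableSet.compl, hπ_fst,
          ← Measure.snd_apply hL.isClosed.measurableSet.compl, hπ_snd]
    _ ≤ ε / 2 + ε / 2 := add_le_add (hμK μ rfl) (hνL ν rfl)
    _ = ε := ENNReal.add_halves ε

end Couplings

section CrossMoment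

variable {Ω E : Type*} [MeasurableSpace Ω] {P : Measure Ω} {d : Ω → ℝ} [TopologicalSpace E]
  [MeasurableSpace E] [BorelSpace E] {T : Ω → E}

theorem integrable_mul_boundedContinuousFunction (hd : Integrable d P) (hT : Measurable T)
    (φ : E →ᵇ ℝ) : Integrable (fun ω => d ω * φ (T ω)) P :=
  hd.mul_bdd (φ.continuous.measurable.comp hT).aestronglyMeasurable
    (ae_of_all _ fun ω => φ.norm_coe_le_norm (T ω))

/-- The functional `φ ↦ E[d φ(T)]` on bounded continuous functions; it is the weak form of the
conditional expectation of `d` given `T`. -/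
noncomputable def crossMoment (hd : Integrable d P) (hT : Measurable T) : (E →ᵇ ℝ) →ₗ[ℝ] ℝ where
  toFun φ := ∫ ω, d ω * φ (T ω) ∂P
  map_add' φ ψ := by
    rw [← integral_add (integrable_mul_boundedContinuousFunction hd hT φ)
      (integrable_mul_boundedContinuousFunction hd hT ψ)]
    simp only [BoundedContinuousFunction.add_apply, mul_add]
  map_smul' c φ := by
    rw [RingHom.id_apply, smul_eq_mul, ← integral_const_mul]
    simp only [BoundedContinuousFunction.smul_apply, smul_eq_mul, mul_left_comm]

theorem crossMoment_apply (hd : Integrable d P) (hT : Measurable T) (φ : E →ᵇ ℝ) :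
    crossMoment hd hT φ = ∫ ω, d ω * φ (T ω) ∂P := rfl

theorem integral_map_withDensity_ofReal (hd : Integrable d P) (hT : Measurable T) (φ : E →ᵇ ℝ) :
    ∫ x, φ x ∂(P.withDensity fun ω => ENNReal.ofReal (d ω)).map T
      = ∫ ω, max (d ω) 0 * φ (T ω) ∂P := by
  rw [integral_map hT.aemeasurable φ.continuous.measurable.aestronglyMeasurable,
    integral_withDensity_eq_integral_toReal_smul₀ hd.1.aemeasurable.ennreal_ofReal
      (ae_of_all _ fun _ => ENNReal.ofReal_lt_top)]
  simp only [ENNReal.toReal_ofReal', smul_eq_mul]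

variable [HasOuterApproxClosed E]

theorem setIntegral_preimage_eq_zero_of_crossMoment_eq_zero (hd : Integrable d P)
    (hT : Measurable T) (h : crossMoment hd hT = 0) {B : Set E} (hB : MeasurableSet B) :
    ∫ ω in T ⁻¹' B, d ω ∂P = 0 := by
  have := isFiniteMeasure_withDensity_ofReal hd.2
  have := isFiniteMeasure_withDensity_ofReal hd.neg.2
  have h_parts : (P.withDensity fun ω => ENNReal.ofReal (d ω)).map T
      = (P.withDensity fun ω => ENNReal.ofReal (-d ω)).map T := by
    refine ext_of_forall_integral_eq_of_IsFiniteMeasure fun φ => ?_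
    have h_neg := integral_map_withDensity_ofReal hd.neg hT φ
    have h_int_neg := integrable_mul_boundedContinuousFunction hd.neg.pos_part hT φ
    simp only [Pi.neg_apply] at h_neg h_int_neg
    rw [integral_map_withDensity_ofReal hd hT, h_neg, ← sub_eq_zero, ← integral_sub
      (integrable_mul_boundedContinuousFunction hd.pos_part hT φ) h_int_neg]
    simp only [← sub_mul, max_zero_sub_max_neg_zero_eq_self]
    exact LinearMap.congr_fun h φ
  have h_mass := congrArg (· B) h_parts
  simp only [Measure.map_apply hT hB, withDensity_apply _ (hT hB)] at h_mass
  rw [integral_eq_lintegral_pos_part_sub_lintegral_neg_part hd.integrableOn, h_mass, sub_self]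

theorem condExp_comap_ae_eq_of_crossMoment_sub_eq_zero [IsFiniteMeasure P] {Y : Ω → ℝ} {w : E → ℝ}
    (hY : Integrable Y P) (hT : Measurable T) (hw : Measurable w)
    (hwT : Integrable (fun ω => w (T ω)) P) (h : crossMoment (hY.sub hwT) hT = 0) :
    P[Y | MeasurableSpace.comap T inferInstance] =ᵐ[P] fun ω => w (T ω) := by
  refine (ae_eq_condExp_of_forall_setIntegral_eq hT.comap_le hY (fun _ _ _ => hwT.integrableOn)
    ?_ (hw.comp (comap_measurable T)).stronglyMeasurable.aestronglyMeasurable).symm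
  rintro _ ⟨B, hB, rfl⟩ -
  have h_zero := setIntegral_preimage_eq_zero_of_crossMoment_eq_zero _ hT h hB
  simp only [Pi.sub_apply] at h_zero
  rw [integral_sub hY.integrableOn hwT.integrableOn, sub_eq_zero] at h_zero
  exact h_zero.symm

end CrossMoment

section Strassen

-- Otherwise Hahn–Banach, in the weak topology of the algebraic dual, separates `0` from `range L`
-- by evaluation at some `v`, and `L s (-v) < 0` for all `s`.
theorem exists_eq_zero_of_convex_range_of_forall_exists_nonneg {S V : Type*} [TopologicalSpace S]
    [CompactSpace S] [AddCommGroup V] [Module ℝ V] {L : S → V →ₗ[ℝ] ℝ}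
    (hcont : ∀ v, Continuous fun s => L s v) (hconv : Convex ℝ (range L))
    (hnonneg : ∀ v, ∃ s, 0 ≤ L s v) : ∃ s, L s = 0 := by
  by_contra! hne
  let B : (V →ₗ[ℝ] ℝ) →ₗ[ℝ] V →ₗ[ℝ] ℝ := LinearMap.id
  let L' : S → WeakBilin B := L
  have hL' : Continuous L' := WeakBilin.continuous_of_continuous_eval B hcont
  have : T2Space (WeakBilin B) := (WeakBilin.isEmbedding (B := B) fun _ _ h => h).t2Space
  have hclosed : IsClosed (range L') := (isCompact_range hL').isClosed
  have hnotMem : (0 : WeakBilin B) ∉ range L' := fun ⟨s, hs⟩ => hne s hs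
  obtain ⟨f, r, hr, hrL⟩ := geometric_hahn_banach_point_closed (E := WeakBilin B) hconv hclosed
    hnotMem
  obtain ⟨v, rfl⟩ := LinearMap.dualEmbedding_surjective B f
  obtain ⟨s, hs⟩ := hnonneg (-v)
  have h_pos : r < L s v := hrL _ (mem_range_self s)
  rw [map_zero] at hr
  rw [map_neg] at hs
  linarith

variable {E : Type*} [MeasurableSpace E] [TopologicalSpace E] [PolishSpace E] [BorelSpace E]

theorem exists_mem_couplings_condExp_fst_ae_eq {μ : Measure E} [IsProbabilityMeasure μ]
    {ν : Measure ℝ} [IsProbabilityMeasure ν] (hν : Integrable id ν) {z : E → ℝ}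
    (hzm : Measurable z) (hz : Integrable z μ) (hmean : μ[z] = ν[id])
    (hle : stopLoss μ z ≤ stopLoss ν id) :
    ∃ π ∈ couplings μ ν,
      (π : Measure (E × ℝ))[Prod.snd | MeasurableSpace.comap Prod.fst inferInstance]
        =ᵐ[(π : Measure (E × ℝ))] fun p => z p.1 := by
  have hy : ∀ π : couplings μ ν, Integrable Prod.snd (π.1 : Measure (E × ℝ)) := fun π =>
    (measurePreserving_snd_of_mem_couplings π.2).integrable_comp_of_integrable hν
  have hzx : ∀ π : couplings μ ν, Integrable (fun p => z p.1) (π.1 : Measure (E × ℝ)) := fun π =>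
    (measurePreserving_fst_of_mem_couplings π.2).integrable_comp_of_integrable hz
  let L : couplings μ ν → (E →ᵇ ℝ) →ₗ[ℝ] ℝ := fun π =>
    crossMoment ((hy π).sub (hzx π)) measurable_fst
  have hL_apply : ∀ π φ, L π φ = ∫ p, p.2 * φ p.1 ∂(π.1 : Measure (E × ℝ)) - ∫ x, z x * φ x ∂μ := by
    intro π φ
    rw [← integral_comp_fst_of_mem_couplings π.2 (by fun_prop)]
    rw [← integral_sub (integrable_mul_boundedContinuousFunction (hy π) measurable_fst φ)
      (integrable_mul_boundedContinuousFunction (hzx π) measurable_fst φ)]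
    simp only [L, crossMoment_apply, Pi.sub_apply, sub_mul]
  have hcont : ∀ φ, Continuous fun π => L π φ := fun φ => by
    simp_rw [hL_apply]
    exact (continuousOn_iff_continuous_domRestrict.1
      (continuousOn_couplings_integral_mul hν φ)).sub continuous_const
  have hconv : Convex ℝ (range L) := by
    rintro _ ⟨π₁, rfl⟩ _ ⟨π₂, rfl⟩ a b ha hb hab
    obtain ⟨π, hπ, h_int⟩ := exists_mem_couplings_integral_eq_add π₁.2 π₂.2 ha hb hab
    refine ⟨⟨π, hπ⟩, LinearMap.ext fun φ => ?_⟩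
    have hyφ := fun π => integrable_mul_boundedContinuousFunction (hy π) measurable_fst φ
    simp only [LinearMap.add_apply, LinearMap.smul_apply, hL_apply, smul_eq_mul]
    rw [h_int _ (hyφ π₁) (hyφ π₂)]
    linear_combination (∫ x, z x * φ x ∂μ) * hab
  have hnonneg : ∀ φ, ∃ π, 0 ≤ L π φ := fun φ => by
    obtain ⟨π, hπ, h⟩ := exists_mem_couplings_integral_sub_mul_nonneg hν hz hmean hle
      φ.continuous.measurable φ.norm_coe_le_norm
    exact ⟨⟨π, hπ⟩, h⟩
  have : CompactSpace (couplings μ ν) := isCompact_iff_compactSpace.1 (isCompact_couplings μ ν)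
  obtain ⟨π, hπ⟩ := exists_eq_zero_of_convex_range_of_forall_exists_nonneg hcont hconv hnonneg
  exact ⟨π.1, π.2, condExp_comap_ae_eq_of_crossMoment_sub_eq_zero (hy π) measurable_fst hzm
    (hzx π) hπ⟩

end Strassen

section ConvexOrder

variable {Ω : Type*} [MeasurableSpace Ω] {P : Measure Ω} {f g : Ω → ℝ}

theorem extExpectation_eq_integral (hf : Integrable f P) :
    extExpectation P f = ((∫ ω, f ω ∂P : ℝ) : EReal) := by
  have h_neg : ∫⁻ ω, ENNReal.ofReal (-f ω) ∂P ≠ ⊤ := hf.neg.lintegral_lt_top.ne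
  rw [extExpectation, integral_eq_lintegral_pos_part_sub_lintegral_neg_part hf, EReal.coe_sub,
    EReal.coe_ennreal_toReal hf.lintegral_lt_top.ne, EReal.coe_ennreal_toReal h_neg]

theorem extExpectation_eq_top (hf : AEStronglyMeasurable f P) (hg : Integrable g P) (hgf : g ≤ f)
    (hf_not : ¬ Integrable f P) : extExpectation P f = ⊤ := by
  have h_neg : ∫⁻ ω, ENNReal.ofReal (-f ω) ∂P ≠ ⊤ :=
    ne_top_of_le_ne_top hg.neg.lintegral_lt_top.ne
      (lintegral_mono fun ω => ENNReal.ofReal_le_ofReal (neg_le_neg (hgf ω)))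
  have h_pos : ∫⁻ ω, ENNReal.ofReal (f ω) ∂P = ⊤ := by
    by_contra h_fin
    have h_pos_part : Integrable (fun ω => max (f ω) 0) P :=
      (lintegral_ofReal_ne_top_iff_integrable (f := fun ω => max (f ω) 0)
        (hf.sup aestronglyMeasurable_const) (ae_of_all _ fun _ => le_max_right _ _)).1
        (by simpa only [ENNReal.ofReal_max, ENNReal.ofReal_zero, max_zero] using h_fin)
    exact hf_not (integrable_of_le_of_le hf (ae_of_all _ hgf) (ae_of_all _ fun _ => le_max_left _ _)
      hg h_pos_part)
  rw [extExpectation, h_pos, EReal.coe_ennreal_top]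
  exact EReal.top_sub (by simpa using h_neg)

theorem extExpectation_eq_of_identDistrib {Ω' : Type*} [MeasurableSpace Ω'] {P' : Measure Ω'}
    {f' : Ω' → ℝ} (h : IdentDistrib f f' P P') : extExpectation P f = extExpectation P' f' := by
  have h_pos := (h.comp ENNReal.measurable_ofReal).lintegral_eq
  have h_neg := (h.comp (ENNReal.measurable_ofReal.comp measurable_neg)).lintegral_eq
  simp only [Function.comp_apply] at h_pos h_neg
  rw [extExpectation, extExpectation, h_pos, h_neg]

theorem continuous_of_convexOn_univ {φ : ℝ → ℝ} (hφ : ConvexOn ℝ univ φ) : Continuous φ :=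
  continuousOn_univ.1 (hφ.continuousOn isOpen_univ)

theorem extExpectation_comp_le_of_condExp_ae_eq {Ω : Type*} {m m₀ : MeasurableSpace Ω}
    {P : Measure Ω} [IsFiniteMeasure P] {Y Z : Ω → ℝ} (hY : Integrable Y P) (hm : m ≤ m₀)
    (hZ : P[Y | m] =ᵐ[P] Z) {φ : ℝ → ℝ} (hφ : ConvexOn ℝ univ φ) :
    extExpectation P (fun ω => φ (Z ω)) ≤ extExpectation P (fun ω => φ (Y ω)) := by
  have hcont := continuous_of_convexOn_univ hφ
  obtain ⟨c, c', hminorant⟩ :=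
    hφ.exists_affine_le_real isClosed_univ (hcont.lowerSemicontinuous.lowerSemicontinuousOn _)
  have h_affine {W : Ω → ℝ} (hW : Integrable W P) : Integrable (fun ω => c * W ω + c') P :=
    (hW.const_mul c).add (integrable_const c')
  by_cases hφY : Integrable (fun ω => φ (Y ω)) P
  · have hZ_int : Integrable Z P := integrable_condExp.congr hZ
    have h_jensen : ∀ᵐ ω ∂P, φ (Z ω) ≤ P[φ ∘ Y | m] ω := by
      filter_upwards [hφ.map_condExp_le_univ hm hcont.lowerSemicontinuous hY hφY, hZ] with ω h h_eq
      rwa [← h_eq]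
    have hφZ : Integrable (fun ω => φ (Z ω)) P :=
      integrable_of_le_of_le (hcont.comp_aestronglyMeasurable hZ_int.1)
        (ae_of_all _ fun ω => hminorant (Z ω) (mem_univ _)) h_jensen (h_affine hZ_int)
        integrable_condExp
    rw [extExpectation_eq_integral hφZ, extExpectation_eq_integral hφY, EReal.coe_le_coe_iff]
    exact (integral_mono_ae hφZ integrable_condExp h_jensen).trans_eq (integral_condExp hm)
  · rw [extExpectation_eq_top (hcont.comp_aestronglyMeasurable hY.1) (h_affine hY)
      (fun ω => hminorant (Y ω) (mem_univ _)) hφY]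
    exact le_top

theorem convexOn_max_sub_zero (k : ℝ) : ConvexOn ℝ univ fun x : ℝ => max (x - k) 0 :=
  ((convexOn_id convex_univ).sub (concaveOn_const k convex_univ)).sup (convexOn_const 0 convex_univ)

theorem ConvexDominates.stopLoss_le [IsFiniteMeasure P] (h : ConvexDominates P f g) :
    stopLoss P g ≤ stopLoss P f := fun k => by
  have h_le := h.2.2 _ (convexOn_max_sub_zero k)
  rwa [extExpectation_eq_integral (integrable_max_sub_zero h.1 k),
    extExpectation_eq_integral (integrable_max_sub_zero h.2.1 k), EReal.coe_le_coe_iff] at h_le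

theorem ConvexDominates.integral_sq_le (h : ConvexDominates P f g) (hf : MemLp f 2 P)
    (hg : MemLp g 2 P) : ∫ ω, g ω ^ 2 ∂P ≤ ∫ ω, f ω ^ 2 ∂P := by
  have h_le := h.2.2 _ (Even.convexOn_pow (n := 2) even_two)
  rwa [extExpectation_eq_integral hf.integrable_sq, extExpectation_eq_integral hg.integrable_sq,
    EReal.coe_le_coe_iff] at h_le

end ConvexOrder

section Centering

variable {Ω : Type*} [MeasurableSpace Ω] {P : Measure Ω} {F : Type*} [NormedAddCommGroup F]
  [NormedSpace ℝ F]

section Law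

variable [MeasurableSpace F] [BorelSpace F]

theorem measurable_centered {A : Ω → F} (hA : Measurable A) : Measurable (centered P A) :=
  hA.sub_const _

theorem comap_centered (P : Measure Ω) (A : Ω → F) :
    MeasurableSpace.comap (centered P A) inferInstance = MeasurableSpace.comap A inferInstance := by
  have h_shift := (MeasurableEquiv.subRight (∫ ω, A ω ∂P)).measurableEmbedding.comap_eq
  conv_rhs => rw [← h_shift, MeasurableSpace.comap_comp]
  rfl

theorem identDistrib_centered {Ω' : Type*} [MeasurableSpace Ω'] {P' : Measure Ω'} {A : Ω → F}
    {A' : Ω' → F} (h : IdentDistrib A A' P P') :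
    IdentDistrib (centered P A) (centered P' A') P P' := by
  have h_comp := h.comp (measurable_id.sub_const (∫ ω, A ω ∂P))
  unfold centered
  rwa [← h.integral_eq]

end Law

section FiniteMeasure

variable [IsFiniteMeasure P]

theorem memLp_centered {A : Ω → F} {r : ENNReal} (hA : MemLp A r P) : MemLp (centered P A) r P :=
  hA.sub (memLp_const _)

theorem integrable_centered {A : Ω → F} (hA : Integrable A P) : Integrable (centered P A) P :=
  hA.sub (integrable_const _)

end FiniteMeasure

variable [CompleteSpace F]

theorem integral_centered [IsProbabilityMeasure P] {A : Ω → F} (hA : Integrable A P) :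
    P[centered P A] = 0 := by
  simp only [centered]
  rw [integral_sub hA (integrable_const _), integral_const, probReal_univ, one_smul, sub_self]

theorem condExp_centered_ae_eq {Ω : Type*} {m m₀ : MeasurableSpace Ω} {P : Measure Ω}
    [IsFiniteMeasure P] (hm : m ≤ m₀) {A : Ω → F} (hA : Integrable A P) :
    P[centered P A | m] =ᵐ[P] fun ω => (P[A | m]) ω - P[A] := by
  have h_sub := condExp_sub hA (integrable_const P[A]) m
  rwa [condExp_const hm] at h_sub

end Centering

/-- The directions `β` in which the stop-loss transform of `⟪U, β⟫` lies below that of `V`. For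
centered `U` and `V` these are the `β` such that `V` dominates `⟪U, β⟫` in the convex order. -/
def dominatedDirections {Ω F : Type*} [MeasurableSpace Ω] [NormedAddCommGroup F]
    [InnerProductSpace ℝ F] (P : Measure Ω) (U : Ω → F) (V : Ω → ℝ) : Set F :=
  {β | stopLoss P (fun ω => inner ℝ (U ω) β) ≤ stopLoss P V}

section DominatedDirections

variable {Ω : Type*} [MeasurableSpace Ω] {P : Measure Ω} {F : Type*} [NormedAddCommGroup F]
  [InnerProductSpace ℝ F] {U : Ω → F} {V : Ω → ℝ}

theorem dominatedDirections_eq_iInter : dominatedDirections P U V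
    = ⋂ k : ℝ, {β | stopLoss P (fun ω => inner ℝ (U ω) β) k ≤ stopLoss P V k} := by
  ext β
  simp only [dominatedDirections, Pi.le_def, mem_ofPred_eq, mem_iInter]

theorem zero_mem_dominatedDirections [IsProbabilityMeasure P] (U : Ω → F) (hV : Integrable V P)
    (hV_mean : P[V] = 0) : (0 : F) ∈ dominatedDirections P U V := fun k => by
  have h_const : stopLoss P (fun ω => inner ℝ (U ω) 0) k = max (0 - k) 0 := by
    simp only [stopLoss, inner_zero_right, integral_const, probReal_univ, one_smul]
  have h_mean := mul_mean_sub_le_stopLoss hV ⟨zero_le_one, le_rfl⟩ k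
  rw [h_const]
  exact max_le (by rwa [one_mul, hV_mean] at h_mean) (stopLoss_nonneg k)

theorem integral_inner_const_eq_zero [CompleteSpace F] (hU : Integrable U P) (hU_mean : P[U] = 0)
    (q : F) : ∫ ω, inner ℝ (U ω) q ∂P = 0 := by
  simp_rw [real_inner_comm q]
  rw [integral_inner hU q, hU_mean, inner_zero_right]

theorem isBounded_setOf_integral_abs_inner_le [FiniteDimensional ℝ F]
    (hU : Integrable U P)
    (hU_ne : ∀ q : F, q ≠ 0 → ¬ ∀ᵐ ω ∂P, inner ℝ (U ω) q = 0) (r : ℝ) :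
    Bornology.IsBounded {β : F | ∫ ω, |inner ℝ (U ω) β| ∂P ≤ r} := by
  let T : F →ₗ[ℝ] Ω →₁[P] ℝ :=
    { toFun := fun β => (hU.inner_const β).toL1 _
      map_add' := fun x y => by
        rw [← Integrable.toL1_add]
        simp only [inner_add_right]
        rfl
      map_smul' := fun c x => by
        rw [RingHom.id_apply, ← Integrable.toL1_smul]
        simp only [real_inner_smul_right, smul_eq_mul] }
  have hT_norm (β : F) : ‖T β‖ = ∫ ω, |inner ℝ (U ω) β| ∂P :=
    L1.norm_of_fun_eq_integral_norm (hU.inner_const β)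
  have hT_ker : LinearMap.ker T = ⊥ := LinearMap.ker_eq_bot'.2 fun q hq => by
    by_contra hq0
    exact hU_ne q hq0 ((Integrable.toL1_eq_toL1_iff _ _ (hU.inner_const q)
      (integrable_zero Ω ℝ P)).1 hq)
  obtain ⟨K, -, hK⟩ := T.exists_antilipschitzWith hT_ker
  refine (hK.isBounded_preimage (Metric.isBounded_closedBall (x := 0) (r := r))).subset
    fun β hβ => ?_
  rw [mem_preimage, mem_closedBall_zero_iff, hT_norm]
  exact hβ

section FiniteMeasure

variable [IsFiniteMeasure P]

theorem convexOn_stopLoss_inner (hU : Integrable U P) (k : ℝ) :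
    ConvexOn ℝ univ fun β : F => stopLoss P (fun ω => inner ℝ (U ω) β) k := by
  have h_int (β : F) := integrable_max_sub_zero (hU.inner_const β) k
  refine ⟨convex_univ, fun x _ y _ a b ha hb hab => ?_⟩
  calc stopLoss P (fun ω => inner ℝ (U ω) (a • x + b • y)) k
      ≤ ∫ ω, (a * max (inner ℝ (U ω) x - k) 0 + b * max (inner ℝ (U ω) y - k) 0) ∂P := by
        refine integral_mono (h_int _) (((h_int x).const_mul a).add ((h_int y).const_mul b))
          fun ω => ?_
        simpa only [inner_add_right, real_inner_smul_right, smul_eq_mul] using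
          (convexOn_max_sub_zero k).2 (mem_univ (inner ℝ (U ω) x)) (mem_univ (inner ℝ (U ω) y))
            ha hb hab
    _ = _ := by
        rw [integral_add ((h_int x).const_mul a) ((h_int y).const_mul b), integral_const_mul,
          integral_const_mul]
        rfl

theorem convex_dominatedDirections (hU : Integrable U P) (V : Ω → ℝ) :
    Convex ℝ (dominatedDirections P U V) := by
  rw [dominatedDirections_eq_iInter]
  refine convex_iInter fun k => ?_
  simpa only [mem_univ, true_and] using (convexOn_stopLoss_inner hU k).convex_le (stopLoss P V k)

variable [FiniteDimensional ℝ F]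

theorem isClosed_dominatedDirections (hU : Integrable U P) (V : Ω → ℝ) :
    IsClosed (dominatedDirections P U V) := by
  rw [dominatedDirections_eq_iInter]
  refine isClosed_iInter fun k => isClosed_le ?_ continuous_const
  exact continuousOn_univ.1 ((convexOn_stopLoss_inner hU k).continuousOn isOpen_univ)

theorem isCompact_dominatedDirections (hU : Integrable U P) (hU_mean : P[U] = 0)
    (hU_ne : ∀ q : F, q ≠ 0 → ¬ ∀ᵐ ω ∂P, inner ℝ (U ω) q = 0) (V : Ω → ℝ) :
    IsCompact (dominatedDirections P U V) := by
  have : CompleteSpace F := FiniteDimensional.complete ℝ F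
  refine Metric.isCompact_of_isClosed_isBounded (isClosed_dominatedDirections hU V)
    ((isBounded_setOf_integral_abs_inner_le hU hU_ne (2 * stopLoss P V 0)).subset fun β hβ => ?_)
  rw [mem_ofPred_eq, integral_abs_eq_two_mul_stopLoss_zero (hU.inner_const β)
    (integral_inner_const_eq_zero hU hU_mean β)]
  exact mul_le_mul_of_nonneg_left (hβ 0) zero_le_two

end FiniteMeasure

end DominatedDirections

section Identification

variable {Ω : Type*} [MeasurableSpace Ω] {P : Measure Ω} [IsProbabilityMeasure P]
  {p : ℕ} {X : Ω → EuclideanSpace ℝ (Fin p)} {Y : Ω → ℝ}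

theorem convexDominates_of_mem_identifiedSet (hX : Integrable X P) (hY : Integrable Y P)
    {β : EuclideanSpace ℝ (Fin p)} (hβ : β ∈ identifiedSet (P.map Y) (P.map X)) :
    ConvexDominates P (centered P Y) (fun ω => inner ℝ (centered P X ω) β) := by
  obtain ⟨Ω', _, P', X', Y', _, hX', hY', hXX, hYY, hcond⟩ := hβ
  have hX_id : IdentDistrib X X' P P' := ⟨hX.aemeasurable, hX'.aemeasurable, hXX.symm⟩
  have hY_id : IdentDistrib Y Y' P P' := ⟨hY.aemeasurable, hY'.aemeasurable, hYY.symm⟩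
  refine ⟨integrable_centered hY, (integrable_centered hX).inner_const β, fun φ hφ => ?_⟩
  have hφ_meas : Measurable φ := (continuous_of_convexOn_univ hφ).measurable
  calc extExpectation P (fun ω => φ (inner ℝ (centered P X ω) β))
      = extExpectation P' (fun ω => φ (inner ℝ (centered P' X' ω) β)) :=
        extExpectation_eq_of_identDistrib ((identDistrib_centered hX_id).comp
          (u := fun x => φ (inner ℝ x β)) (hφ_meas.comp (by fun_prop)))
    _ ≤ extExpectation P' (fun ω => φ (centered P' Y' ω)) :=
        extExpectation_comp_le_of_condExp_ae_eq
          (integrable_centered (hY_id.integrable_iff.1 hY)) (measurable_centered hX').comap_le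
          hcond hφ
    _ = extExpectation P (fun ω => φ (centered P Y ω)) :=
        extExpectation_eq_of_identDistrib ((identDistrib_centered hY_id).symm.comp hφ_meas)

theorem mem_identifiedSet_of_mem_couplings {μ : Measure (EuclideanSpace ℝ (Fin p))}
    {ν : Measure ℝ} (hν : Integrable id ν) {β : EuclideanSpace ℝ (Fin p)}
    {π : ProbabilityMeasure (EuclideanSpace ℝ (Fin p) × ℝ)} (hπ : π ∈ couplings μ ν)
    (hcond : π.toMeasure[Prod.snd | MeasurableSpace.comap Prod.fst inferInstance]
      =ᵐ[π.toMeasure] fun x => inner ℝ (centered μ id x.1) β + ν[id]) :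
    β ∈ identifiedSet ν μ := by
  have h_fst_pres := measurePreserving_fst_of_mem_couplings hπ
  have h_snd_pres := measurePreserving_snd_of_mem_couplings hπ
  refine ⟨_, _, π.toMeasure, Prod.fst, Prod.snd, inferInstance, measurable_fst, measurable_snd,
    h_fst_pres.map_eq, h_snd_pres.map_eq, ?_⟩
  have h_fst : π.toMeasure[Prod.fst] = μ[id] := by
    rw [← h_fst_pres.map_eq, integral_map measurable_fst.aemeasurable aestronglyMeasurable_id]
    rfl
  have h_snd : π.toMeasure[Prod.snd] = ν[id] := integral_comp_snd_of_mem_couplings hπ hν.1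
  rw [comap_centered]
  filter_upwards [condExp_centered_ae_eq measurable_fst.comap_le
    (h_snd_pres.integrable_comp_of_integrable hν), hcond] with x h_centered h_cond
  refine h_centered.trans ?_
  change _ - π.toMeasure[Prod.snd] = _
  rw [centered, h_fst, h_snd]
  exact sub_eq_of_eq_add h_cond

theorem stopLoss_add_const_le_iff {Ω : Type*} [MeasurableSpace Ω] {P : Measure Ω}
    (f g : Ω → ℝ) (c : ℝ) :
    stopLoss P (fun ω => f ω + c) ≤ stopLoss P (fun ω => g ω + c) ↔
      stopLoss P f ≤ stopLoss P g := by
  have h_shift (f : Ω → ℝ) (k : ℝ) : stopLoss P (fun ω => f ω + c) k = stopLoss P f (k - c) := by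
    simp only [stopLoss, sub_sub_eq_add_sub]
  simp only [Pi.le_def, h_shift]
  exact (Equiv.subRight c).forall_congr fun _ => Iff.rfl

theorem mem_identifiedSet_of_mem_dominatedDirections (hX : Integrable X P) (hY : Integrable Y P)
    {β : EuclideanSpace ℝ (Fin p)}
    (hβ : β ∈ dominatedDirections P (centered P X) (centered P Y)) :
    β ∈ identifiedSet (P.map Y) (P.map X) := by
  have : IsProbabilityMeasure (P.map X) := Measure.isProbabilityMeasure_map hX.aemeasurable
  have : IsProbabilityMeasure (P.map Y) := Measure.isProbabilityMeasure_map hY.aemeasurable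
  have hμ : Integrable id (P.map X) :=
    (integrable_map_measure aestronglyMeasurable_id hX.aemeasurable).2 hX
  have hν : Integrable id (P.map Y) :=
    (integrable_map_measure aestronglyMeasurable_id hY.aemeasurable).2 hY
  have hμ_mean : (P.map X)[id] = P[X] := integral_map hX.aemeasurable aestronglyMeasurable_id
  have hν_mean : (P.map Y)[id] = P[Y] := integral_map hY.aemeasurable aestronglyMeasurable_id
  have h_sub : Integrable (centered (P.map X) id) (P.map X) := integrable_centered hμ
  set z : EuclideanSpace ℝ (Fin p) → ℝ :=
    fun x => inner ℝ (centered (P.map X) id x) β + (P.map Y)[id]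
  have hz_meas : Measurable z :=
    ((measurable_centered measurable_id).inner measurable_const).add_const _
  have hz : Integrable z (P.map X) := (h_sub.inner_const β).add (integrable_const _)
  have hz_mean : (P.map X)[z] = (P.map Y)[id] := by
    refine (integral_add (h_sub.inner_const β) (integrable_const _)).trans ?_
    rw [integral_inner_const_eq_zero h_sub (integral_centered hμ), zero_add, integral_const,
      probReal_univ, one_smul]
  have hz_le : stopLoss (P.map X) z ≤ stopLoss (P.map Y) id := by
    rw [stopLoss_map hX.aemeasurable hz_meas, stopLoss_map hY.aemeasurable measurable_id]
    have h_shift := (stopLoss_add_const_le_iff _ (centered P Y) P[Y]).2 hβ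
    have h_centered (ω : Ω) : centered (P.map X) id (X ω) = centered P X ω :=
      congrArg (X ω - ·) hμ_mean
    simp only [z, h_centered, hν_mean]
    simpa only [centered, sub_add_cancel, id_eq] using h_shift
  obtain ⟨π, hπ, hcond⟩ := exists_mem_couplings_condExp_fst_ae_eq hν hz_meas hz hz_mean hz_le
  exact mem_identifiedSet_of_mem_couplings hν hπ hcond

theorem identifiedSet_eq_setOf_convexDominates (hX : Integrable X P) (hY : Integrable Y P) :
    identifiedSet (P.map Y) (P.map X)
      = {β | ConvexDominates P (centered P Y) (fun ω => inner ℝ (centered P X ω) β)} :=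
  Subset.antisymm (fun _ hβ => convexDominates_of_mem_identifiedSet hX hY hβ)
    fun _ hβ => mem_identifiedSet_of_mem_dominatedDirections hX hY hβ.stopLoss_le

theorem identifiedSet_eq_dominatedDirections (hX : Integrable X P) (hY : Integrable Y P) :
    identifiedSet (P.map Y) (P.map X) = dominatedDirections P (centered P X) (centered P Y) :=
  Subset.antisymm (fun _ hβ => (convexDominates_of_mem_identifiedSet hX hY hβ).stopLoss_le)
    fun _ hβ => mem_identifiedSet_of_mem_dominatedDirections hX hY hβ

end Identification

section Polar

variable {Ω : Type*} [MeasurableSpace Ω] {P : Measure Ω} [IsProbabilityMeasure P] {A B : Ω → ℝ}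

theorem cdfOf_const_mul (hA : AEMeasurable A P) {l : ℝ} (hl : 0 < l) :
    cdfOf P (fun ω => l * A ω) = fun x => cdfOf P A (x / l) := by
  have := Measure.isProbabilityMeasure_map hA
  have := Measure.isProbabilityMeasure_map (hA.const_mul l)
  ext x
  rw [cdfOf, cdfOf, cdf_eq_real, cdf_eq_real,
    map_measureReal_apply_of_aemeasurable (hA.const_mul l) measurableSet_Iic,
    map_measureReal_apply_of_aemeasurable hA measurableSet_Iic]
  congr 1
  ext ω
  rw [mem_preimage, mem_preimage, mem_Iic, mem_Iic, le_div_iff₀' hl]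

section Superquantile

variable (hA : Integrable A P) (hA_mean : P[A] = 0)
include hA hA_mean

theorem superquantile_nonneg {α : ℝ} (hα : α ∈ Ioo (0 : ℝ) 1) :
    0 ≤ ∫ t in α..1, genInv (cdfOf P A) t := by
  have := Measure.isProbabilityMeasure_map hA.aemeasurable
  have h_mean : (P.map A)[id] = 0 :=
    (integral_map hA.aemeasurable aestronglyMeasurable_id).trans hA_mean
  have h_le := mul_mean_le_intervalIntegral_genInv_cdf
    ((integrable_map_measure aestronglyMeasurable_id hA.aemeasurable).2 hA) hα
  rwa [h_mean, mul_zero] at h_le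

theorem superquantile_pos (hA_ne : ¬ A =ᵐ[P] 0) {α : ℝ} (hα : α ∈ Ioo (0 : ℝ) 1) :
    0 < ∫ t in α..1, genInv (cdfOf P A) t := by
  have := Measure.isProbabilityMeasure_map hA.aemeasurable
  exact intervalIntegral_genInv_cdf_pos
    ((integrable_map_measure aestronglyMeasurable_id hA.aemeasurable).2 hA)
    ((integral_map hA.aemeasurable aestronglyMeasurable_id).trans hA_mean)
    (fun h => hA_ne (ae_of_ae_map hA.aemeasurable h)) hα

variable (hB : Integrable B P) (hB_mean : P[B] = 0)
include hB hB_mean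

theorem stopLoss_le_iff_superquantile_le :
    stopLoss P B ≤ stopLoss P A ↔ ∀ α ∈ Ioo (0 : ℝ) 1,
      ∫ t in α..1, genInv (cdfOf P B) t ≤ ∫ t in α..1, genInv (cdfOf P A) t := by
  have := Measure.isProbabilityMeasure_map hA.aemeasurable
  have := Measure.isProbabilityMeasure_map hB.aemeasurable
  have h_iff := stopLoss_le_iff_intervalIntegral_genInv_cdf_le
    ((integrable_map_measure aestronglyMeasurable_id hB.aemeasurable).2 hB)
    ((integrable_map_measure aestronglyMeasurable_id hA.aemeasurable).2 hA)
    (by rw [integral_map hB.aemeasurable aestronglyMeasurable_id,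
      integral_map hA.aemeasurable aestronglyMeasurable_id]; exact hB_mean.trans hA_mean.symm)
  rwa [stopLoss_map hB.aemeasurable measurable_id, stopLoss_map hA.aemeasurable measurable_id]
    at h_iff

variable (hB_ne : ¬ B =ᵐ[P] 0)
include hB_ne

theorem superquantileRatio_nonneg (α : Ioo (0 : ℝ) 1) :
    0 ≤ superquantileRatio α (cdfOf P A) (cdfOf P B) :=
  div_nonneg (superquantile_nonneg hA hA_mean α.2) (superquantile_pos hB hB_mean hB_ne α.2).le

theorem infRatio_nonneg : 0 ≤ infRatio (cdfOf P A) (cdfOf P B) :=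
  Real.iInf_nonneg (superquantileRatio_nonneg hA hA_mean hB hB_mean hB_ne)

theorem stopLoss_const_mul_le_iff_le_infRatio {l : ℝ} (hl : 0 < l) :
    stopLoss P (fun ω => l * B ω) ≤ stopLoss P A ↔ l ≤ infRatio (cdfOf P A) (cdfOf P B) := by
  have : Nonempty (Ioo (0 : ℝ) 1) := nonempty_Ioo_subtype zero_lt_one
  have h_bdd : BddBelow (range fun α : Ioo (0 : ℝ) 1 =>
      superquantileRatio α (cdfOf P A) (cdfOf P B)) :=
    ⟨0, forall_mem_range.2 (superquantileRatio_nonneg hA hA_mean hB hB_mean hB_ne)⟩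
  rw [stopLoss_le_iff_superquantile_le hA hA_mean (hB.const_mul l)
    (by rw [integral_const_mul, hB_mean, mul_zero]), infRatio, le_ciInf_iff h_bdd, Subtype.forall]
  refine forall₂_congr fun α hα => ?_
  rw [superquantileRatio, le_div_iff₀ (superquantile_pos hB hB_mean hB_ne hα),
    cdfOf_const_mul hB.aemeasurable hl]
  simp only [genInv_comp_div _ hl, intervalIntegral.integral_const_mul]

end Superquantile

theorem dominatedDirections_eq_setOf_smul {F : Type*} [NormedAddCommGroup F]
    [InnerProductSpace ℝ F] [CompleteSpace F] [Nontrivial F] {U : Ω → F} {V : Ω → ℝ}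
    (hU : Integrable U P) (hV : Integrable V P) (hU_mean : P[U] = 0) (hV_mean : P[V] = 0)
    (hU_ne : ∀ q : F, q ≠ 0 → ¬ ∀ᵐ ω ∂P, inner ℝ (U ω) q = 0) :
    dominatedDirections P U V = {β | ∃ q ∈ Metric.sphere (0 : F) 1, ∃ l : ℝ, 0 ≤ l ∧
      l ≤ infRatio (cdfOf P V) (cdfOf P fun ω => inner ℝ (U ω) q) ∧ β = l • q} := by
  have h_mean := integral_inner_const_eq_zero hU hU_mean
  have h_ne (q : F) (hq : q ∈ Metric.sphere (0 : F) 1) :=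
    hU_ne q (Metric.ne_of_mem_sphere hq one_ne_zero)
  have h_smul_mem (q : F) (hq : q ∈ Metric.sphere (0 : F) 1) {l : ℝ} (hl : 0 < l) :
      l • q ∈ dominatedDirections P U V ↔
        l ≤ infRatio (cdfOf P V) (cdfOf P fun ω => inner ℝ (U ω) q) := by
    rw [← stopLoss_const_mul_le_iff_le_infRatio hV hV_mean (hU.inner_const q) (h_mean q)
      (h_ne q hq) hl]
    simp only [dominatedDirections, mem_ofPred_eq, real_inner_smul_right]
  ext β
  constructor
  · intro hβ
    rcases eq_or_ne β 0 with rfl | hβ0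
    · obtain ⟨q, hq⟩ := NormedSpace.sphere_nonempty (x := (0 : F)).2 zero_le_one
      exact ⟨q, hq, 0, le_rfl, infRatio_nonneg hV hV_mean (hU.inner_const q) (h_mean q)
        (h_ne q hq), (zero_smul ℝ q).symm⟩
    · have h_unit : ‖β‖⁻¹ • β ∈ Metric.sphere (0 : F) 1 :=
        mem_sphere_zero_iff_norm.2 (norm_smul_inv_norm hβ0)
      have h_polar : β = ‖β‖ • (‖β‖⁻¹ • β) := (smul_inv_smul₀ (norm_ne_zero_iff.2 hβ0) β).symm
      exact ⟨_, h_unit, ‖β‖, norm_nonneg β,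
        (h_smul_mem _ h_unit (norm_pos_iff.2 hβ0)).1 (h_polar ▸ hβ), h_polar⟩
  · rintro ⟨q, hq, l, hl0, hl, rfl⟩
    rcases hl0.eq_or_lt with rfl | hl_pos
    · rw [zero_smul]
      exact zero_mem_dominatedDirections U hV hV_mean
    · exact (h_smul_mem q hq hl_pos).2 hl

end Polar

section Covariance

variable {Ω : Type*} [MeasurableSpace Ω] {P : Measure Ω}

theorem inner_centered {F : Type*} [NormedAddCommGroup F] [InnerProductSpace ℝ F] [CompleteSpace F]
    {X : Ω → F} (hX : Integrable X P) (β : F) :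
    (fun ω => inner ℝ (centered P X ω) β) = centered P fun ω => inner ℝ (X ω) β := by
  ext ω
  simp only [centered, real_inner_comm β]
  rw [integral_inner hX β, inner_sub_right]

variable [IsFiniteMeasure P] {p : ℕ} {X : Ω → EuclideanSpace ℝ (Fin p)}

theorem covMatrix_mulVec_apply (hX : MemLp X 2 P) (β : EuclideanSpace ℝ (Fin p)) (i : Fin p) :
    (covMatrix P X).mulVec β.ofLp i
      = covariance (fun ω => X ω i) (fun ω => inner ℝ (X ω) β) P := by
  have h_coord := MemLp.eval_piLp hX
  simp only [PiLp.inner_apply, RCLike.inner_apply, conj_trivial]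
  rw [covariance_fun_sum_right (fun j => (h_coord j).const_mul (β j)) (h_coord i)]
  simp only [covariance_const_mul_right, Matrix.mulVec, dotProduct, covMatrix,
    Matrix.of_apply, mul_comm]

theorem dotProduct_covMatrix_mulVec (hX : MemLp X 2 P) (β : EuclideanSpace ℝ (Fin p)) :
    β.ofLp ⬝ᵥ (covMatrix P X).mulVec β.ofLp = variance (fun ω => inner ℝ (X ω) β) P := by
  have h_inner : MemLp (fun ω => inner ℝ (X ω) β) 2 P := hX.inner_const β
  have h_coord := MemLp.eval_piLp hX
  simp only [dotProduct, covMatrix_mulVec_apply hX, ← covariance_const_mul_left]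
  rw [← covariance_fun_sum_left (fun j => (h_coord j).const_mul (β j)) h_inner,
    ← covariance_self h_inner.aemeasurable]
  simp only [PiLp.inner_apply, RCLike.inner_apply, conj_trivial]

theorem not_ae_inner_centered_eq_zero (hX : MemLp X 2 P) (hV : (covMatrix P X).det ≠ 0)
    {q : EuclideanSpace ℝ (Fin p)} (hq : q ≠ 0) :
    ¬ ∀ᵐ ω ∂P, inner ℝ (centered P X ω) q = 0 := by
  intro h
  have h_kernel : (covMatrix P X).mulVec q.ofLp = 0 := by
    ext i
    rw [covMatrix_mulVec_apply hX]
    refine integral_eq_zero_of_ae ?_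
    filter_upwards [h] with ω hω
    have h_dev := congrFun (inner_centered (hX.integrable one_le_two) q) ω
    exact mul_eq_zero_of_right _ (h_dev.symm.trans hω)
  exact hq (WithLp.ofLp_injective 2 (Matrix.eq_zero_of_mulVec_eq_zero hV h_kernel))

theorem ConvexDominates.dotProduct_covMatrix_mulVec_le {Y : Ω → ℝ} {β : EuclideanSpace ℝ (Fin p)}
    (h : ConvexDominates P (centered P Y) (fun ω => inner ℝ (centered P X ω) β))
    (hX : MemLp X 2 P) (hY : MemLp Y 2 P) :
    β.ofLp ⬝ᵥ (covMatrix P X).mulVec β.ofLp ≤ variance Y P := by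
  have h_inner : MemLp (fun ω => inner ℝ (X ω) β) 2 P := hX.inner_const β
  rw [inner_centered (hX.integrable one_le_two)] at h
  rw [dotProduct_covMatrix_mulVec hX, variance_eq_integral h_inner.aemeasurable,
    variance_eq_integral hY.aemeasurable]
  exact h.integral_sq_le (memLp_centered hY) (memLp_centered h_inner)

end Covariance

theorem theorem1_general {Ω : Type*} [MeasurableSpace Ω] (P : Measure Ω) [IsProbabilityMeasure P]
    {p : ℕ} (hp : 1 ≤ p) (X : Ω → EuclideanSpace ℝ (Fin p)) (Y : Ω → ℝ)
    (hX2 : MemLp X 2 P) (hY2 : MemLp Y 2 P) (hVX : (covMatrix P X).det ≠ 0) :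
    identifiedSet (P.map Y) (P.map X) =
      {β | ∃ q ∈ Metric.sphere (0 : EuclideanSpace ℝ (Fin p)) 1, ∃ l : ℝ,
        0 ≤ l ∧
        l ≤ infRatio (cdfOf P (centered P Y))
          (cdfOf P (fun ω => inner ℝ (centered P X ω) q)) ∧
        β = l • q} ∧
    identifiedSet (P.map Y) (P.map X) =
      {β | ConvexDominates P (centered P Y) (fun ω => inner ℝ (centered P X ω) β)} ∧
    (0 : EuclideanSpace ℝ (Fin p)) ∈ identifiedSet (P.map Y) (P.map X) ∧
    Convex ℝ (identifiedSet (P.map Y) (P.map X)) ∧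
    IsCompact (identifiedSet (P.map Y) (P.map X)) ∧
    identifiedSet (P.map Y) (P.map X) ⊆
      {β | β.ofLp ⬝ᵥ ((covMatrix P X).mulVec β.ofLp) ≤ variance Y P} := by
  have : Nonempty (Fin p) := ⟨⟨0, hp⟩⟩
  have hX : Integrable X P := hX2.integrable one_le_two
  have hY : Integrable Y P := hY2.integrable one_le_two
  have hU := integrable_centered hX
  have hV := integrable_centered hY
  have hU_ne := fun q => not_ae_inner_centered_eq_zero (q := q) hX2 hVX
  have h_convex := identifiedSet_eq_setOf_convexDominates hX hY
  have h_dominated := identifiedSet_eq_dominatedDirections hX hY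
  refine ⟨h_dominated.trans ?_, h_convex, ?_, ?_, ?_, h_convex.subset.trans fun β hβ => ?_⟩
  · exact dominatedDirections_eq_setOf_smul hU hV (integral_centered hX) (integral_centered hY)
      hU_ne
  · exact h_dominated ▸ zero_mem_dominatedDirections _ hV (integral_centered hY)
  · exact h_dominated ▸ convex_dominatedDirections hU _
  · exact h_dominated ▸ isCompact_dominatedDirections hU (integral_centered hX) hU_ne _
  · exact ConvexDominates.dotProduct_covMatrix_mulVec_le hβ hX2 hY2

theorem theorem1 {Ω : Type*} [MeasurableSpace Ω] (P : Measure Ω) [IsProbabilityMeasure P]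
    {p : ℕ} (hp : 1 ≤ p)
    (X : Ω → EuclideanSpace ℝ (Fin p)) (Y : Ω → ℝ)
    (hX : Measurable X) (hY : Measurable Y)
    (hX2 : MemLp X 2 P) (hY2 : MemLp Y 2 P)
    (hVY : 0 < variance Y P)
    (hVX : (covMatrix P X).det ≠ 0)
    (α₀ : ℝ) (β₀ : EuclideanSpace ℝ (Fin p))
    (hlin : P[Y | MeasurableSpace.comap X inferInstance]
      =ᵐ[P] fun ω => α₀ + inner ℝ (X ω) β₀) :
    identifiedSet (P.map Y) (P.map X) =
      {β | ∃ q ∈ Metric.sphere (0 : EuclideanSpace ℝ (Fin p)) 1, ∃ l : ℝ,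
        0 ≤ l ∧
        l ≤ infRatio (cdfOf P (centered P Y))
          (cdfOf P (fun ω => inner ℝ (centered P X ω) q)) ∧
        β = l • q} ∧
    identifiedSet (P.map Y) (P.map X) =
      {β | ConvexDominates P (centered P Y) (fun ω => inner ℝ (centered P X ω) β)} ∧
    (0 : EuclideanSpace ℝ (Fin p)) ∈ identifiedSet (P.map Y) (P.map X) ∧
    Convex ℝ (identifiedSet (P.map Y) (P.map X)) ∧
    IsCompact (identifiedSet (P.map Y) (P.map X)) ∧
    identifiedSet (P.map Y) (P.map X) ⊆
      {β | β.ofLp ⬝ᵥ ((covMatrix P X).mulVec β.ofLp) ≤ variance Y P} :=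
  theorem1_general P hp X Y hX2 hY2 hVX
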